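/- **Conventions.** Let $A$ be a set with a quasi-ordering $\le_A$ and a norm $|\cdot|_A : A \to \mathbb{N}$. For $g : \mathbb{N} \to \mathbb{N}$ and $n \in \mathbb{N}$, a finite sequence $x_0, x_1, \dots$ over $A$ is *bad* if $x_i \not\le_A x_j$ for all $i < j$, and *$(g,n)$-controlled* if $|x_i|_A \le g^i(n)$ for all $i$, where $g^i$ is the $i$-fold iterate. $L_{A,g}(n)$ denotes the maximum length of a $(g,n)$-controlled bad sequence over $A$. For $d \ge 1$, $\mathbb{N}^d$ has the componentwise order and the norm $|x| = \max_i x_i$; on the set $\mathbb{P}_f(\mathbb{N}^d)$ of finite subsets of $\mathbb{N}^d$ the majoring ordering is $X \sqsubseteq^{\mathrm{maj}} Y \iff \forall x \in X\ \exists y \in Y\ x \le y$, with norm $|X| = \max(\{|x| : x \in X\} \cup \{\mathrm{card}(X)\})$. For an ordinal $\alpha = \omega^{\beta_1} c_1 + \dots + \omega^{\beta_m} c_m < \varepsilon_0$ with $\beta_1 > \dots > \beta_m$ and $c_i > 0$, let $N\alpha = \max\{c_1, \dots, c_m, N\beta_1, \dots, N\beta_m\}$ (and $N0 = 0$). $L_{\alpha,g}$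 is the length function of the set of ordinals $< \alpha$ with the usual order and the norm $N$. Limit ordinals have the fundamental sequences $(\gamma + \omega^{\beta+1})(x) = \gamma + \omega^{\beta}\cdot(x+1)$ and $(\gamma + \omega^{\lambda})(x) = \gamma + \omega^{\lambda(x)}$ (the left-hand sides being in Cantor normal form); $P_x(\alpha+1) = \alpha$ and $P_x(\lambda) = P_x(\lambda(x))$; and the Cichoń hierarchy for $g$ is $g_0(x) = 0$, $g_\alpha(x) = 1 + g_{P_x(\alpha)}(g(x))$ for $\alpha > 0$. **Theorem.** Let $d \ge 1$, let $g : \mathbb{N} \to \mathbb{N}$ be strictly increasing and inflationary ($g(m) \ge m$ for all $m$), let $\alpha = \omega^{\omega^{d-1}}$, $\varphi(x) = x(x+1)^d$, and let $n \ge N\alpha$. Then the maximum lengths $L_{\alpha,g}(n)$ and $L_{(\mathbb{P}_f(\mathbb{N}^d), \sqsubseteq^{\mathrm{maj}}),\, \varphi\circ g}(\varphi(n))$ exist, and $$g_\alpha(n) = L_{\alpha,g}(n) \le L_{(\mathbb{P}_f(\mathbb{N}^d), \sqsubseteq^{\mathrm{maj}}),\, \varphi\circ g}(\varphi(n)).$$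 -/

import Mathlib

/-! ### Controlled bad sequences and length functions -/

/-- A finite sequence `x₀, x₁, …` is bad for the relation `le` if `¬ le xᵢ xⱼ` for all `i < j`. -/
def IsBadSeq {A : Type*} (le : A → A → Prop) (s : List A) : Prop :=
  s.Pairwise (fun x y => ¬ le x y)

/-- The finite sequence `x₀, x₁, …` is `(g, n)`-controlled if `|xᵢ| ≤ gⁱ(n)` for all `i`. -/
def IsControlledSeq {A : Type*} (norm : A → ℕ) (g : ℕ → ℕ) (n : ℕ) (s : List A) : Prop :=
  ∀ (i : ℕ) (hi : i < s.length), norm s[i] ≤ g^[i] n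

/-- The set of all lengths of `(g, n)`-controlled bad sequences over `(A, le, norm)`. -/
def badSeqLengths {A : Type*} (le : A → A → Prop) (norm : A → ℕ) (g : ℕ → ℕ) (n : ℕ) : Set ℕ :=
  {l | ∃ s : List A, IsBadSeq le s ∧ IsControlledSeq norm g n s ∧ s.length = l}

/-- The length function `L_{A,g}(n)`: the maximum length of a `(g, n)`-controlled bad sequence over
`(A, le, norm)`. -/
noncomputable def lengthFn {A : Type*} (le : A → A → Prop) (norm : A → ℕ) (g : ℕ → ℕ) (n : ℕ) : ℕ :=
  sSup (badSeqLengths le norm g n)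

/-! ### Finite subsets of `ℕ^d` with the majoring ordering -/

/-- The majoring ordering on finite subsets: every `x ∈ X` lies below some `y ∈ Y`. -/
def majLE {A : Type*} [LE A] (X Y : Finset A) : Prop :=
  ∀ x ∈ X, ∃ y ∈ Y, x ≤ y

/-- The norm of a finite set: the maximum of the norms of its elements and of its cardinality. -/
def finsetNorm {A : Type*} (norm : A → ℕ) (X : Finset A) : ℕ :=
  max (X.sup norm) X.card

/-- The norm on `ℕ^d`: the maximum of the coordinates. -/
def vecNorm {d : ℕ} (x : Fin d → ℕ) : ℕ :=
  Finset.univ.sup x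

/-- The length function of the finite subsets of `ℕ^d` (with the componentwise order) under the
majoring ordering. -/
noncomputable def majLength (d : ℕ) (g : ℕ → ℕ) (n : ℕ) : ℕ :=
  lengthFn (A := Finset (Fin d → ℕ)) majLE (finsetNorm vecNorm) g n

/-! ### Ordinals below `ε₀`

Ordinals below `ε₀` are represented by Mathlib's type `NONote` of Cantor normal forms
`ω^e * n + a` with `n ≥ 1`, ordered by the ordinals that they denote. -/

/-- The norm `N`: the largest coefficient that occurs in the (hereditary) strict Cantor normal
form. -/
def ordNorm : ONote → ℕ
  | ONote.zero => 0
  | ONote.oadd e n a => max (n : ℕ) (max (ordNorm e) (ordNorm a))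

/-- The ordinal `ω ^ β`. -/
def omegaPow (β : NONote) : NONote :=
  ⟨ONote.oadd β.1 1 0, ONote.NF.oadd_zero β.1 1⟩

theorem repr_omegaPow (β : NONote) : (omegaPow β).repr = Ordinal.omega0 ^ β.repr := by
  simp [omegaPow, NONote.repr]

/-- The ordinal `ω ^ (ω ^ k)`. -/
def omegaOmegaPow (k : ℕ) : NONote :=
  omegaPow (omegaPow (NONote.ofNat k))

theorem repr_omegaOmegaPow (k : ℕ) :
    (omegaOmegaPow k).repr = Ordinal.omega0 ^ (Ordinal.omega0 ^ (k : Ordinal)) := by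
  rw [omegaOmegaPow, repr_omegaPow, repr_omegaPow]
  simp [NONote.repr, NONote.ofNat]

/-- `CNF(α)`: the ordinals strictly below `α`. -/
abbrev CNFBelow (α : NONote) : Type := {β : NONote // β < α}

/-- The norm `N` on `CNF(α)`. -/
def cnfNorm {α : NONote} (β : CNFBelow α) : ℕ :=
  ordNorm β.1.1

/-- The length function `L_{α,g}` of `CNF(α)` with the usual ordering of ordinals. -/
noncomputable def ordLength (α : NONote) (g : ℕ → ℕ) (n : ℕ) : ℕ :=
  lengthFn (A := CNFBelow α) (· ≤ ·) cnfNorm g n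

/-- The predecessor `P_x`: `P_x(α + 1) = α` and `P_x(λ) = P_x(λ(x))` for a limit `λ`, where
`(γ + ω^(β+1))(x) = γ + ω^β * (x + 1)` and `(γ + ω^λ)(x) = γ + ω^(λ(x))` (which is Mathlib's
`ONote.fundamentalSequence`). The value at `0` is irrelevant. -/
def predAt (x : ℕ) : ONote → ONote
  | o =>
    match ONote.fundamentalSequence o, ONote.fundamentalSequence_has_prop o with
    | Sum.inl none, _ => 0
    | Sum.inl (some a), _ => a
    | Sum.inr f, h =>
      have : f x < o := (h.2.1 x).2.1
      predAt x (f x)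
  termination_by o => o

theorem predAt_lt (x : ℕ) (o : ONote) (ho : o ≠ 0) : predAt x o < o := by
  induction o using WellFounded.induction (r := (· < · : ONote → ONote → Prop))
    (InvImage.wf ONote.repr Ordinal.lt_wf) with
  | _ o ih =>
    rw [predAt]
    split
    · next h _ _ => exact absurd h ho
    · next a h _ _ =>
      rw [ONote.lt_def, h.1]
      exact Order.lt_succ _
    · next f h _ _ =>
      have hlt : f x < o := (h.2.1 x).2.1
      by_cases h0 : f x = 0
      · have h1 : f (x + 1) < o := (h.2.1 (x + 1)).2.1
        have h2 : predAt x (f x) = 0 := by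
          rw [h0, predAt]
          rfl
        rw [h2, ← h0]
        exact hlt
      · exact lt_trans (ih (f x) hlt h0) hlt

/-- The Cichoń hierarchy: `h_0(x) = 0` and `h_α(x) = 1 + h_{P_x(α)}(h(x))` for `α > 0`. -/
def cichon (h : ℕ → ℕ) (o : ONote) (x : ℕ) : ℕ :=
  if ho : o = 0 then 0
  else
    have : predAt x o < o := predAt_lt x o ho
    1 + cichon h (predAt x o) (h x)
  termination_by o

/-! ### The predecessor `P_x` -/

/-! For the equality, `P_x(o)` is an upper bound for the ordinals below `o` of norm at most `x`
(`le_predAt`), and itself has norm at most `x` when `o` does (`ordNorm_predAt_le`). Bad sequences of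
ordinals are strictly decreasing, so the greedy sequence `P_n(α)`, `P_{g(n)}(P_n(α))`, … is a
longest controlled one, and its length obeys the Cichoń recursion (`isGreatest_cichon`).

For the inequality, with `k = d - 1`, an ordinal `ω^e₁ c₁ + ⋯ + ω^eₘ cₘ` below `ω^ω^k` has exponents
below `ω^k`, each coded by its coefficient vector in `ℕ^k`. It is sent to the set of vectors `(c₁ +
⋯ + cᵢ, digits of eᵢ)` in `ℕ^(k+1)`. This map reflects the order (`exists_mem_termSet_not_le`) and
takes norm `N` to norm at most `N (N+1)^k` (`finsetNorm_termSet_le`), so controlled bad sequences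
are carried to controlled bad sequences (`badSeqLengths_subset`).

The maximum for finite sets exists by Higman's lemma and a König argument (`isGreatest_lengthFn`).
-/

theorem lt_oadd_cases {e a c b : ONote} {n m : ℕ+} (h₁ : (ONote.oadd e n c).NF)
    (h₂ : (ONote.oadd a m b).NF) (h : ONote.oadd e n c < ONote.oadd a m b) :
    e < a ∨ e = a ∧ (n : ℕ) < m ∨ e = a ∧ n = m ∧ c < b := by
  have he := h₁.fst
  have ha := h₂.fst
  rcases lt_trichotomy e.repr a.repr with hlt | heq | hgt
  · exact Or.inl hlt
  · obtain rfl := ONote.repr_inj.1 heq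
    rcases lt_trichotomy (n : ℕ) m with hlt | hnm | hgt
    · exact Or.inr (Or.inl ⟨rfl, hlt⟩)
    · obtain rfl := PNat.coe_injective hnm
      refine Or.inr (Or.inr ⟨rfl, rfl, ?_⟩)
      rw [ONote.lt_def] at h ⊢
      simpa using h
    · exact absurd h (lt_asymm (ONote.oadd_lt_oadd_2 h₂ hgt))
  · exact absurd h (lt_asymm (ONote.oadd_lt_oadd_1 h₂ hgt))

theorem lt_oadd_of_nfBelow {c e : ONote} (b : ONote) (n : ℕ+)
    (h : c.NFBelow e.repr) : c < ONote.oadd e n b :=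
  lt_of_lt_of_le (b := Ordinal.omega0 ^ e.repr) h.repr_lt (ONote.omega0_le_oadd e n b)

/-- If the leading exponent of `c` is `a'`, its coefficient is at most `x`, hence less than the
factor `x + 1` of the fundamental sequence. -/
theorem lt_oadd_succPNat {c a a' : ONote} {x : ℕ} (ha' : a'.NF)
    (h : a.repr = Order.succ a'.repr) (hc : c.NFBelow a.repr) (hx : ordNorm c ≤ x) :
    c < ONote.oadd a' x.succPNat 0 := by
  cases c with
  | zero => exact ONote.oadd_pos _ _ _
  | oadd e n c =>
    have hlt := hc.lt
    rw [h, Order.lt_succ_iff] at hlt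
    rcases hlt.lt_or_eq with hlt | heq
    · exact lt_oadd_of_nfBelow _ _ (ONote.NF.below_of_lt hlt ⟨_, hc⟩)
    · have := hc.fst
      obtain rfl := ONote.repr_inj.1 heq
      refine ONote.oadd_lt_oadd_2 ⟨_, hc⟩ ?_
      simp only [ordNorm] at hx
      simp only [Nat.succPNat_coe]
      omega

theorem lt_oadd_one_of_forall {c a a' : ONote} {x : ℕ}
    (h : ∀ e : ONote, e.NF → e < a → ordNorm e ≤ x → e < a') (hc : c.NFBelow a.repr)
    (hx : ordNorm c ≤ x) : c < ONote.oadd a' 1 0 := by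
  cases c with
  | zero => exact ONote.oadd_pos _ _ _
  | oadd e n c =>
    refine ONote.oadd_lt_oadd_1 ⟨_, hc⟩ (h e hc.fst hc.lt ?_)
    simp only [ordNorm] at hx
    omega

theorem eq_zero_of_fundamentalSequence {o : ONote}
    (h : o.fundamentalSequence = Sum.inl none) : o = 0 := by
  have := o.fundamentalSequence_has_prop
  rwa [h] at this

theorem succ_of_fundamentalSequence {o a : ONote}
    (h : o.fundamentalSequence = Sum.inl (some a)) :
    o.repr = Order.succ a.repr ∧ (o.NF → a.NF) := by
  have := o.fundamentalSequence_has_prop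
  rwa [h] at this

theorem limit_of_fundamentalSequence {o : ONote} {f : ℕ → ONote}
    (h : o.fundamentalSequence = Sum.inr f) (i : ℕ) : f i < o ∧ (o.NF → (f i).NF) := by
  have := o.fundamentalSequence_has_prop
  rw [h] at this
  exact (this.2.1 i).2

theorem eq_one_of_natPred {m : ℕ+} (h : m.natPred = 0) : m = 1 := by
  have := PNat.natPred_add_one m
  exact PNat.coe_injective (by simp only [PNat.one_coe]; omega)

theorem coe_eq_of_natPred {m : ℕ+} {k : ℕ} (h : m.natPred = k + 1) : (m : ℕ) = k + 2 := by
  have := PNat.natPred_add_one m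
  omega

/-- The fundamental sequence of `ω^a * (k + 2)` keeps `ω^a * (k + 1)` and expands the last copy of
`ω^a`. Only a `c` starting with exactly `ω^a * (k + 1)` needs the bound `e` on its tail. -/
theorem lt_oadd_pred {e a c : ONote} {m : ℕ+} {k : ℕ} (hm : m.natPred = k + 1) {x : ℕ}
    (ho : (ONote.oadd a m 0).NF)
    (h : ∀ b : ONote, b.NFBelow a.repr → ordNorm b ≤ x → b < e) (hc : c.NF)
    (hlt : c < ONote.oadd a m 0) (hx : ordNorm c ≤ x) : c < ONote.oadd a k.succPNat e := by
  cases c with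
  | zero => exact ONote.oadd_pos _ _ _
  | oadd e' n c =>
    have hm' := coe_eq_of_natPred hm
    rcases lt_oadd_cases hc ho hlt with h1 | ⟨rfl, h1⟩ | ⟨rfl, rfl, h1⟩
    · exact ONote.oadd_lt_oadd_1 hc h1
    · rcases (show (n : ℕ) ≤ k + 1 by omega).lt_or_eq with h2 | h2
      · exact ONote.oadd_lt_oadd_2 hc (by simpa using h2)
      · obtain rfl : n = k.succPNat := PNat.coe_injective (by simpa using h2)
        refine ONote.oadd_lt_oadd_3 (h c hc.snd' ?_)
        simp only [ordNorm] at hx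
        omega
    · exact absurd h1 (by simp [ONote.lt_def])

/-- Below a limit, the ordinals of norm at most `x` stay below the `x`-th element of the
fundamental sequence. -/
theorem lt_fundamentalSequence {o : ONote} {f : ℕ → ONote} {x : ℕ}
    (hf : o.fundamentalSequence = Sum.inr f) (ho : o.NF) {c : ONote} (hc : c.NF) (hlt : c < o)
    (hx : ordNorm c ≤ x) : c < f x := by
  induction o generalizing f c with
  | zero => cases hf
  | oadd a m b iha ihb =>
    rw [ONote.fundamentalSequence] at hf
    rcases hb : b.fundamentalSequence with (_ | b') | g <;> simp only [hb] at hf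
    · obtain rfl := eq_zero_of_fundamentalSequence hb
      rcases ha : a.fundamentalSequence with (_ | a') | g <;> rcases hm : m.natPred with _ | k <;>
        simp only [ha, hm, reduceCtorEq, Sum.inr.injEq] at hf
      · obtain ⟨h1, h2⟩ := succ_of_fundamentalSequence ha
        obtain rfl := eq_one_of_natPred hm
        subst hf
        refine lt_oadd_succPNat (h2 ho.fst) h1 (ONote.NF.below_of_lt' ?_ hc) hx
        simpa [ONote.lt_def] using hlt
      · obtain ⟨h1, h2⟩ := succ_of_fundamentalSequence ha
        subst hf
        exact lt_oadd_pred hm ho (fun d hd hdx => lt_oadd_succPNat (h2 ho.fst) h1 hd hdx)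
          hc hlt hx
      · obtain rfl := eq_one_of_natPred hm
        subst hf
        refine lt_oadd_one_of_forall (fun e he hea hex => iha ha ho.fst he hea hex)
          (ONote.NF.below_of_lt' ?_ hc) hx
        simpa [ONote.lt_def] using hlt
      · subst hf
        exact lt_oadd_pred hm ho (fun d hd hdx => lt_oadd_one_of_forall
          (fun e he hea hex => iha ha ho.fst he hea hex) hd hdx) hc hlt hx
    · cases hf
    · cases hf
      cases c with
      | zero => exact ONote.oadd_pos _ _ _
      | oadd e n c =>
        rcases lt_oadd_cases hc ho hlt with h1 | ⟨rfl, h1⟩ | ⟨rfl, rfl, h1⟩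
        · exact ONote.oadd_lt_oadd_1 hc h1
        · exact ONote.oadd_lt_oadd_2 hc h1
        · refine ONote.oadd_lt_oadd_3 (ihb hb ho.snd hc.snd h1 ?_)
          simp only [ordNorm] at hx
          omega

/-! ### Unfolding the predecessor; its extremality -/

theorem predAt_zero (x : ℕ) : predAt x 0 = 0 := by
  rw [predAt]
  rfl

theorem predAt_of_succ {x : ℕ} {o a : ONote}
    (h : o.fundamentalSequence = Sum.inl (some a)) : predAt x o = a := by
  rw [predAt]
  split
  · next _ h' _ => simp [h] at h'
  · next _ h' _ => simpa [h] using h'.symm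
  · next _ h' _ => simp [h] at h'

theorem predAt_of_limit {x : ℕ} {o : ONote} {f : ℕ → ONote}
    (h : o.fundamentalSequence = Sum.inr f) : predAt x o = predAt x (f x) := by
  rw [predAt]
  split
  · next _ h' _ => simp [h] at h'
  · next _ h' _ => simp [h] at h'
  · next _ h' _ =>
    simp only [h, Sum.inr.injEq] at h'
    rw [h']

theorem predAt_nf {x : ℕ} {o : ONote} (ho : o.NF) : (predAt x o).NF := by
  induction o using WellFounded.induction (r := (· < · : ONote → ONote → Prop))
    (InvImage.wf ONote.repr Ordinal.lt_wf) with
  | _ o ih =>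
    rcases h : o.fundamentalSequence with (_ | a) | f
    · rw [eq_zero_of_fundamentalSequence h, predAt_zero]
      exact ONote.NF.zero
    · rw [predAt_of_succ h]
      exact (succ_of_fundamentalSequence h).2 ho
    · rw [predAt_of_limit h]
      obtain ⟨h1, h2⟩ := limit_of_fundamentalSequence h x
      exact ih _ h1 (h2 ho)

/-- `P_x(o)` bounds all the ordinals below `o` of norm at most `x`. -/
theorem le_predAt {x : ℕ} {o c : ONote} (ho : o.NF) (hc : c.NF) (hlt : c < o)
    (hx : ordNorm c ≤ x) : c ≤ predAt x o := by
  induction o using WellFounded.induction (r := (· < · : ONote → ONote → Prop))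
    (InvImage.wf ONote.repr Ordinal.lt_wf) with
  | _ o ih =>
    rcases h : o.fundamentalSequence with (_ | a) | f
    · rw [eq_zero_of_fundamentalSequence h] at hlt
      exact absurd hlt (by simp [ONote.lt_def])
    · rw [predAt_of_succ h]
      rw [ONote.lt_def, (succ_of_fundamentalSequence h).1, Order.lt_succ_iff] at hlt
      exact hlt
    · rw [predAt_of_limit h]
      obtain ⟨h1, h2⟩ := limit_of_fundamentalSequence h x
      exact ih _ h1 (h2 ho) (lt_fundamentalSequence h ho hc hlt hx)

/-- All the coefficients of the notation are at most `x`, except that the last coefficient at one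
place along the chain of last exponents may be `x + 1`. -/
def AlmostLean (x : ℕ) : ONote → Prop
  | ONote.zero => True
  | ONote.oadd e n a =>
    (a = 0 ∧ ((n : ℕ) ≤ x + 1 ∧ ordNorm e ≤ x ∨ n = 1 ∧ AlmostLean x e)) ∨
      (n : ℕ) ≤ x ∧ ordNorm e ≤ x ∧ AlmostLean x a

theorem almostLean_of_ordNorm_le {x : ℕ} {o : ONote} (h : ordNorm o ≤ x) : AlmostLean x o := by
  induction o with
  | zero => trivial
  | oadd e n a _ iha =>
    simp only [ordNorm] at h
    exact Or.inr ⟨by omega, by omega, iha (by omega)⟩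

theorem almostLean_oadd_of_ne {x : ℕ} {e a : ONote} {n : ℕ+} (ha : a ≠ 0)
    (h : AlmostLean x (ONote.oadd e n a)) :
    (n : ℕ) ≤ x ∧ ordNorm e ≤ x ∧ AlmostLean x a := by
  rcases h with h | h
  · exact absurd h.1 ha
  · exact h

theorem almostLean_oadd_zero {x : ℕ} {e : ONote} {n : ℕ+}
    (h : AlmostLean x (ONote.oadd e n 0)) :
    (n : ℕ) ≤ x + 1 ∧ ordNorm e ≤ x ∨ n = 1 ∧ AlmostLean x e := by
  rcases h with h | h
  · exact h.2
  · exact Or.inl ⟨by omega, h.2.1⟩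

theorem almostLean_exponent {x : ℕ} {e : ONote} {n : ℕ+}
    (h : AlmostLean x (ONote.oadd e n 0)) : AlmostLean x e := by
  rcases almostLean_oadd_zero h with h | h
  · exact almostLean_of_ordNorm_le h.2
  · exact h.2

/-- Almost lean notations are closed under fundamental sequences, and their predecessors are
lean. -/
theorem almostLean_fundamentalSequence {x : ℕ} {o : ONote} (h : AlmostLean x o) :
    (∀ a, o.fundamentalSequence = Sum.inl (some a) → ordNorm a ≤ x) ∧
      ∀ f : ℕ → ONote, o.fundamentalSequence = Sum.inr f → AlmostLean x (f x) := by
  induction o with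
  | zero => exact ⟨fun a ha => (by cases ha), fun f hf => (by cases hf)⟩
  | oadd a m b iha ihb =>
    rw [ONote.fundamentalSequence]
    rcases hb : b.fundamentalSequence with (_ | b') | g
    · obtain rfl := eq_zero_of_fundamentalSequence hb
      have hlean := almostLean_exponent h
      have h' := almostLean_oadd_zero h
      obtain ⟨ih1, ih2⟩ := iha hlean
      -- A last coefficient above `1` may be `x + 1`, but expanding one copy lowers it to at most
      -- `x`, so the only new excess sits in the appended term.
      have hgt : ∀ k, m.natPred = k + 1 → k + 1 ≤ x ∧ ordNorm a ≤ x := by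
        intro k hk
        have := coe_eq_of_natPred hk
        rcases h' with h' | ⟨h', -⟩
        · omega
        · rw [h', PNat.one_coe] at this
          omega
      rcases ha : a.fundamentalSequence with (_ | a') | g <;> rcases hm : m.natPred with _ | k <;>
        simp only [reduceCtorEq, Sum.inr.injEq, Sum.inl.injEq, Option.some.injEq, forall_eq',
          IsEmpty.forall_iff, implies_true, and_true, true_and]
      · simp [ordNorm]
      · have := hgt k hm
        simp only [ordNorm, Nat.succPNat_coe]
        omega
      · exact Or.inl ⟨rfl, Or.inl ⟨by simp, ih1 _ ha⟩⟩
      · have := hgt k hm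
        exact Or.inr ⟨by simpa using this.1, this.2, Or.inl ⟨rfl, Or.inl ⟨by simp, ih1 _ ha⟩⟩⟩
      · exact Or.inl ⟨rfl, Or.inr ⟨rfl, ih2 _ ha⟩⟩
      · have := hgt k hm
        exact Or.inr ⟨by simpa using this.1, this.2, Or.inl ⟨rfl, Or.inr ⟨rfl, ih2 _ ha⟩⟩⟩
    · obtain ⟨h1, h2, h3⟩ := almostLean_oadd_of_ne (by rintro rfl; cases hb) h
      have := (ihb h3).1 _ hb
      simp only [reduceCtorEq, Sum.inl.injEq, Option.some.injEq, forall_eq',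
          IsEmpty.forall_iff, implies_true, and_true, ordNorm]
      omega
    · obtain ⟨h1, h2, h3⟩ := almostLean_oadd_of_ne (by rintro rfl; cases hb) h
      simp only [reduceCtorEq, Sum.inr.injEq, forall_eq', IsEmpty.forall_iff, implies_true,
        true_and]
      exact Or.inr ⟨h1, h2, (ihb h3).2 _ hb⟩

theorem ordNorm_predAt_le {x : ℕ} {o : ONote} (h : AlmostLean x o) :
    ordNorm (predAt x o) ≤ x := by
  induction o using WellFounded.induction (r := (· < · : ONote → ONote → Prop))
    (InvImage.wf ONote.repr Ordinal.lt_wf) with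
  | _ o ih =>
    obtain ⟨h1, h2⟩ := almostLean_fundamentalSequence h
    rcases ho : o.fundamentalSequence with (_ | a) | f
    · rw [eq_zero_of_fundamentalSequence ho, predAt_zero]
      exact Nat.zero_le _
    · rw [predAt_of_succ ho]
      exact h1 _ ho
    · rw [predAt_of_limit ho]
      exact ih _ (limit_of_fundamentalSequence ho x).1 (h2 _ ho)

/-! ### The length function of an initial segment of the ordinals -/

theorem isControlledSeq_cons {A : Type*} {norm : A → ℕ} {g : ℕ → ℕ} {n : ℕ} {a : A} {s : List A} :
    IsControlledSeq norm g n (a :: s) ↔ norm a ≤ n ∧ IsControlledSeq norm g (g n) s := by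
  constructor
  · intro h
    refine ⟨h 0 (by simp), fun i hi => ?_⟩
    have := h (i + 1) (by simpa using hi)
    simpa using this
  · rintro ⟨h1, h2⟩ i hi
    cases i with
    | zero => simpa using h1
    | succ i =>
      have := h2 i (by simpa using hi)
      simpa using this

theorem cichon_zero (h : ℕ → ℕ) (x : ℕ) : cichon h 0 x = 0 := by
  rw [cichon]
  simp

theorem cichon_of_ne {h : ℕ → ℕ} {o : ONote} (ho : o ≠ 0) (x : ℕ) :
    cichon h o x = 1 + cichon h (predAt x o) (h x) := by
  rw [cichon, dif_neg ho]

/-- The first entry is at most `P_n(o)`, and all later entries lie strictly below it, so the tail is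
a sequence below `P_n(o)` controlled from `g n`. -/
theorem length_le_cichon {g : ℕ → ℕ} {o : ONote} (ho : o.NF) {s : List NONote} {n : ℕ}
    (hs : IsBadSeq (· ≤ ·) s) (hlt : ∀ b ∈ s, b.1 < o)
    (hc : IsControlledSeq (fun b : NONote => ordNorm b.1) g n s) :
    s.length ≤ cichon g o n := by
  induction s generalizing o n with
  | nil => exact Nat.zero_le _
  | cons a s ih =>
    obtain ⟨h1, h2⟩ := isControlledSeq_cons.1 hc
    obtain ⟨h3, h4⟩ := List.pairwise_cons.1 hs
    have ha : a.1 < o := hlt a (by simp)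
    have ho0 : o ≠ 0 := by
      rintro rfl
      exact absurd ha (by simp [ONote.lt_def])
    rw [cichon_of_ne ho0, List.length_cons, add_comm]
    gcongr
    exact ih (predAt_nf ho) h4
      (fun b hb => lt_of_lt_of_le (not_le.1 (h3 b hb)) (le_predAt ho a.2 ha h1)) h2

/-- The witness is the greedy sequence of predecessors. Since `g` is inflationary, the bound `n` on
the norm of `P_n(o)` is also a bound by `g n`, which keeps the induction going. -/
theorem exists_length_eq_cichon {g : ℕ → ℕ} (hg : ∀ m, m ≤ g m) {o : ONote} (ho : o.NF) {n : ℕ}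
    (hn : ordNorm o ≤ n) : ∃ s : List NONote, IsBadSeq (· ≤ ·) s ∧ (∀ b ∈ s, b.1 < o) ∧
      IsControlledSeq (fun b : NONote => ordNorm b.1) g n s ∧ s.length = cichon g o n := by
  induction o using WellFounded.induction (r := (· < · : ONote → ONote → Prop))
    (InvImage.wf ONote.repr Ordinal.lt_wf) generalizing n with
  | _ o ih =>
    by_cases ho0 : o = 0
    · subst ho0
      exact ⟨[], List.Pairwise.nil, by simp, fun i hi => by simp at hi, by rw [cichon_zero]; rfl⟩
    · have hlt := predAt_lt n o ho0
      have hpn := ordNorm_predAt_le (almostLean_of_ordNorm_le hn)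
      obtain ⟨s, h1, h2, h3, h4⟩ := ih _ hlt (predAt_nf ho) (hpn.trans (hg n))
      refine ⟨⟨predAt n o, predAt_nf ho⟩ :: s, ?_, ?_, ?_, ?_⟩
      · exact List.pairwise_cons.2 ⟨fun b hb => not_le.2 (h2 b hb), h1⟩
      · rintro b hb
        rcases List.mem_cons.1 hb with rfl | hb
        · exact hlt
        · exact lt_trans (h2 b hb) hlt
      · exact isControlledSeq_cons.2 ⟨hpn, h3⟩
      · rw [cichon_of_ne ho0, add_comm, ← h4]
        rfl

theorem isGreatest_cichon {g : ℕ → ℕ} (hg : ∀ m, m ≤ g m) (α : NONote) {n : ℕ}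
    (hn : ordNorm α.1 ≤ n) :
    IsGreatest (badSeqLengths (A := CNFBelow α) (· ≤ ·) cnfNorm g n) (cichon g α.1 n) := by
  constructor
  · obtain ⟨s, h1, h2, h3, h4⟩ := exists_length_eq_cichon hg α.2 hn
    lift s to List (CNFBelow α) using h2
    refine ⟨s, ?_, fun i hi => ?_, by simpa using h4⟩
    · exact List.pairwise_map.1 h1
    · simpa [cnfNorm] using h3 i (by simpa using hi)
  · rintro l ⟨s, h1, h2, rfl⟩
    rw [← List.length_map (f := Subtype.val)]
    refine length_le_cichon α.2 (List.pairwise_map.2 h1) ?_ fun i hi => ?_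
    · intro b hb
      obtain ⟨c, -, rfl⟩ := List.mem_map.1 hb
      exact c.2
    · simpa [cnfNorm] using h2 i (by simpa using hi)

/-! ### Existence of the length functions of well-quasi-orders -/

section WQO
variable {A : Type*} {le : A → A → Prop} {norm : A → ℕ} {g : ℕ → ℕ} {n : ℕ}

/-- If `s` has arbitrarily long controlled bad extensions then so has `s ++ [x]` for some `x`. -/
theorem exists_extendable_append (hfin : ∀ k, {x : A | norm x ≤ k}.Finite) {s : List A}
    (hs : ∀ l, ∃ t, l ≤ t.length ∧ IsBadSeq le (s ++ t) ∧ IsControlledSeq norm g n (s ++ t)) :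
    ∃ x, ∀ l, ∃ t, l ≤ t.length ∧ IsBadSeq le (s ++ [x] ++ t) ∧
      IsControlledSeq norm g n (s ++ [x] ++ t) := by
  by_contra! hcon
  choose L hL using hcon
  -- Only finitely many `x` are admissible next, so the bounds `L x` on their extensions have a
  -- common bound `M`; an extension of length `M + 1` then contradicts the bound for its own first
  -- entry.
  obtain ⟨M, hM⟩ := ((hfin (g^[s.length] n)).image L).bddAbove
  obtain ⟨t, ht, hbad, hctl⟩ := hs (M + 1)
  cases t with
  | nil => simp at ht
  | cons x t =>
    have hx : norm x ≤ g^[s.length] n := by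
      simpa using hctl s.length (by simp)
    have hLx : L x ≤ M := hM ⟨x, hx, rfl⟩
    have hsx : s ++ x :: t = s ++ [x] ++ t := by simp
    rw [hsx] at hbad hctl
    refine hL x t ?_ hbad hctl
    simp only [List.length_cons] at ht
    omega

theorem bddAbove_badSeqLengths (hle : WellQuasiOrdered le)
    (hfin : ∀ k, {x : A | norm x ≤ k}.Finite) : BddAbove (badSeqLengths le norm g n) := by
  by_contra hcon
  let Ext : List A → Prop := fun s =>
    ∀ l, ∃ t, l ≤ t.length ∧ IsBadSeq le (s ++ t) ∧ IsControlledSeq norm g n (s ++ t)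
  have hnil : Ext [] := by
    intro l
    rw [not_bddAbove_iff] at hcon
    obtain ⟨_, ⟨s, h1, h2, rfl⟩, h3⟩ := hcon l
    exact ⟨s, h3.le, h1, h2⟩
  have hstep : ∀ s : {s // Ext s}, ∃ x, Ext (s.1 ++ [x]) := fun s =>
    exists_extendable_append hfin s.2
  choose next hnext using hstep
  -- König's lemma: iterating the one-step extension produces an infinite sequence all of whose
  -- finite prefixes are bad.
  let u : ℕ → {s // Ext s} := fun k =>
    Nat.rec ⟨[], hnil⟩ (fun _ s => ⟨s.1 ++ [next s], hnext s⟩) k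
  have hu : ∀ k, (u k).1 = (List.range k).map fun i => next (u i) := by
    intro k
    induction k with
    | zero => rfl
    | succ k ih =>
      rw [List.range_succ, List.map_append, ← ih]
      rfl
  obtain ⟨i, j, hij, h⟩ := hle fun i => next (u i)
  obtain ⟨t, -, hbad, -⟩ := (u (j + 1)).2 0
  have h1 := (List.pairwise_append.1 hbad).1
  have h2 : (u (j + 1)).1 = _ := hu (j + 1)
  rw [List.range_succ, List.map_append] at h2
  replace h1 := h2 ▸ h1
  exact (List.pairwise_append.1 h1).2.2 (next (u i))
    (List.mem_map.2 ⟨i, List.mem_range.2 hij, rfl⟩) (next (u j)) (by simp) h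

theorem isGreatest_lengthFn (hle : WellQuasiOrdered le)
    (hfin : ∀ k, {x : A | norm x ≤ k}.Finite) :
    IsGreatest (badSeqLengths le norm g n) (lengthFn le norm g n) := by
  have hb := bddAbove_badSeqLengths (g := g) (n := n) hle hfin
  exact ⟨Nat.sSup_mem ⟨0, [], List.Pairwise.nil, fun i hi => by simp at hi, rfl⟩ hb,
    fun _ h => le_csSup hb h⟩

/-- Order reflections that respect the norm up to `φ` transfer lengths of bad sequences. -/
theorem badSeqLengths_subset {B : Type*} {leB : B → B → Prop} {normB : B → ℕ} (r : A → B)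
    (hr : ∀ x y, leB (r x) (r y) → le x y) {φ : ℕ → ℕ} (hφ : Monotone φ) (hφ' : ∀ m, m ≤ φ m)
    (hg : Monotone g) (hnorm : ∀ x, normB (r x) ≤ φ (norm x)) :
    badSeqLengths le norm g n ⊆ badSeqLengths leB normB (φ ∘ g) (φ n) := by
  have hit : ∀ i, φ (g^[i] n) ≤ (φ ∘ g)^[i] (φ n) := by
    intro i
    induction i with
    | zero => rfl
    | succ i ih =>
      rw [Function.iterate_succ_apply', Function.iterate_succ_apply']
      exact hφ (hg ((hφ' _).trans ih))
  rintro l ⟨s, h1, h2, rfl⟩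
  refine ⟨s.map r, ?_, fun i hi => ?_, by simp⟩
  · exact List.pairwise_map.2 (h1.imp fun h h' => h (hr _ _ h'))
  · rw [List.getElem_map]
    exact (hnorm _).trans ((hφ (h2 i (by simpa using hi))).trans (hit i))

end WQO

/-! ### Finite sets under majoring: well-quasi-ordering and finiteness of norm balls -/

/-- Higman's lemma for lists of elements: a subword embedding, forgetting order and multiplicity, is
a majoring. -/
theorem wellQuasiOrdered_majLE {A : Type*} [Preorder A] [WellQuasiOrderedLE A] :
    WellQuasiOrdered (majLE : Finset A → Finset A → Prop) := by
  intro f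
  have h := Set.PartiallyWellOrderedOn.partiallyWellOrderedOn_sublistForall₂
    (α := A) (· ≤ ·) (s := Set.univ) (Set.partiallyWellOrderedOn_univ_iff.2 wellQuasiOrdered_le)
  obtain ⟨i, j, hij, hle⟩ := Set.partiallyWellOrderedOn_iff_exists_lt.1 h
    (fun i => (f i).toList) (fun _ _ _ => Set.mem_univ _)
  refine ⟨i, j, hij, fun x hx => ?_⟩
  obtain ⟨l, hl, hsub⟩ := List.sublistForall₂_iff.1 hle
  obtain ⟨y, hy, hxy⟩ : ∃ y ∈ l, x ≤ y := by
    have := List.forall₂_iff_get.1 hl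
    obtain ⟨k, hk, rfl⟩ := List.getElem_of_mem (Finset.mem_toList.2 hx)
    exact ⟨l[k]'(this.1 ▸ hk), List.getElem_mem _, this.2 k hk (this.1 ▸ hk)⟩
  exact ⟨y, Finset.mem_toList.1 (hsub.subset hy), hxy⟩

theorem vecNorm_le_iff {d k : ℕ} {x : Fin d → ℕ} : vecNorm x ≤ k ↔ ∀ i, x i ≤ k := by
  simp [vecNorm]

theorem finite_finsetNorm_vecNorm_le (d k : ℕ) :
    {X : Finset (Fin d → ℕ) | finsetNorm vecNorm X ≤ k}.Finite := by
  refine (Finset.finite_toSet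
    (Fintype.piFinset fun _ : Fin d => Finset.range (k + 1)).powerset).subset fun X hX => ?_
  simp only [Finset.coe_powerset, Set.mem_preimage, Set.mem_powerset_iff, Finset.coe_subset]
  intro x hx
  have h : vecNorm x ≤ k := (Finset.le_sup hx).trans ((le_max_left _ _).trans hX)
  simpa [Nat.lt_succ_iff] using vecNorm_le_iff.1 h

/-! ### Reflecting ordinals below `ω ^ ω ^ k` into finite subsets of `ℕ ^ (k + 1)` -/

/-- The coefficient of `ω ^ i` in an ordinal notation. -/
def digit (i : ℕ) : ONote → ℕ
  | ONote.zero => 0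
  | ONote.oadd e n a => if e = ONote.ofNat i then n else digit i a

/-- The vector of the coefficients of an ordinal below `ω ^ k`. -/
def digits (k : ℕ) (o : ONote) : Fin k → ℕ := fun i => digit i o

theorem digit_le_ordNorm (i : ℕ) (o : ONote) : digit i o ≤ ordNorm o := by
  induction o with
  | zero => exact Nat.zero_le _
  | oadd e n a _ ih =>
    simp only [digit, ordNorm]
    split_ifs <;> omega

theorem digit_eq_zero_of_nfBelow {i : ℕ} {o : ONote} {b : Ordinal} (h : o.NFBelow b)
    (hb : b ≤ i) : digit i o = 0 := by
  induction o generalizing b with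
  | zero => rfl
  | oadd e n a _ ih =>
    have hlt := h.lt.trans_le hb
    rw [digit, if_neg, ih h.snd hlt.le]
    rintro rfl
    simp at hlt

/-- The witness is the exponent of the first term at which the two normal forms differ. -/
theorem exists_digit_lt {k : ℕ} {o o' : ONote} (ho : o.NFBelow k) (ho' : o'.NFBelow k)
    (h : o' < o) : ∃ i < k, digit i o' < digit i o := by
  induction o generalizing o' with
  | zero => exact absurd h (by simp [ONote.lt_def])
  | oadd e n a _ ih =>
    have he := ho.fst
    obtain ⟨i, hi⟩ := Ordinal.lt_omega0.1 (ho.lt.trans (Ordinal.natCast_lt_omega0 k))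
    have hik : i < k := by
      have := ho.lt
      rw [hi] at this
      exact_mod_cast this
    obtain rfl : e = ONote.ofNat i := ONote.repr_inj.1 (by simpa using hi)
    have hdig : digit i (ONote.oadd (ONote.ofNat i) n a) = n := by simp [digit]
    cases o' with
    | zero => exact ⟨i, hik, by rw [hdig]; exact n.pos⟩
    | oadd e' n' a' =>
      rcases lt_oadd_cases ⟨_, ho'⟩ ⟨_, ho⟩ h with h1 | ⟨rfl, h1⟩ | ⟨rfl, rfl, h1⟩
      · refine ⟨i, hik, ?_⟩
        rw [hdig, digit_eq_zero_of_nfBelow (b := i) _ le_rfl]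
        · exact n.pos
        · exact ONote.NF.below_of_lt (by simpa [ONote.lt_def] using h1) ⟨_, ho'⟩
      · exact ⟨i, hik, by simpa [digit] using h1⟩
      · obtain ⟨j, hj, hlt⟩ := ih (ho.snd.mono ho.lt.le) (ho'.snd.mono ho'.lt.le) h1
        have hij : ONote.ofNat i ≠ ONote.ofNat j := by
          intro hij
          rw [digit_eq_zero_of_nfBelow ho.snd (by rw [hij]; simp)] at hlt
          omega
        exact ⟨j, hj, by simpa [digit, hij] using hlt⟩

theorem le_of_digits_le {k : ℕ} {o o' : ONote} (ho : o.NFBelow k) (ho' : o'.NFBelow k)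
    (h : digits k o ≤ digits k o') : o ≤ o' := by
  by_contra hcon
  obtain ⟨i, hi, hlt⟩ := exists_digit_lt ho ho' (show o'.repr < o.repr from not_le.1 hcon)
  exact absurd (h ⟨i, hi⟩) (not_le.2 hlt)

/-- The finite set of the vectors `(p + c₁ + ⋯ + cᵢ, eᵢ)` for the ordinal
`ω ^ e₁ * c₁ + ⋯ + ω ^ eₘ * cₘ`, where the exponents are given by their digits. -/
def termSet (k : ℕ) (p : ℕ) : ONote → Finset (Fin (k + 1) → ℕ)
  | ONote.zero => ∅
  | ONote.oadd e n a => insert (Fin.cons (p + n) (digits k e)) (termSet k (p + n) a)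

/-- The digit vectors of the exponents of an ordinal notation. -/
def exponentSet (k : ℕ) : ONote → Finset (Fin k → ℕ)
  | ONote.zero => ∅
  | ONote.oadd e _ a => insert (digits k e) (exponentSet k a)

theorem of_mem_termSet {k p : ℕ} {o : ONote} {b : Ordinal} (ho : o.NFBelow b)
    {y : Fin (k + 1) → ℕ} (hy : y ∈ termSet k p o) :
    p < y 0 ∧ ∃ e : ONote, e.NF ∧ e.repr < b ∧ Fin.tail y = digits k e := by
  induction o generalizing p b with
  | zero => simp [termSet] at hy
  | oadd e n a _ ih =>
    rcases Finset.mem_insert.1 hy with rfl | hy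
    · exact ⟨by simp, e, ho.fst, ho.lt, by simp⟩
    · obtain ⟨h1, e', h2, h3, h4⟩ := ih ho.snd hy
      exact ⟨by omega, e', h2, h3.trans ho.lt, h4⟩

theorem exists_mem_termSet_not_le {k p : ℕ} {o o' : ONote}
    (ho : o.NFBelow (Ordinal.omega0 ^ (k : Ordinal)))
    (ho' : o'.NFBelow (Ordinal.omega0 ^ (k : Ordinal))) (h : o' < o) :
    ∃ x ∈ termSet k p o, ∀ y ∈ termSet k p o', ¬ x ≤ y := by
  -- Terms with smaller exponents never dominate: domination would give `e ≤ e'` through the digits.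
  have key : ∀ {e : ONote} {c : ℕ} {y : Fin (k + 1) → ℕ} {a : ONote} {q : ℕ}, e.NF →
      e.repr < Ordinal.omega0 ^ (k : Ordinal) → a.NFBelow e.repr → y ∈ termSet k q a →
      ¬ (Fin.cons c (digits k e) : Fin (k + 1) → ℕ) ≤ y := by
    intro e c y a q he hek ha hy hle
    obtain ⟨-, e', he', hlt, htail⟩ := of_mem_termSet ha hy
    refine absurd hlt (not_lt.2 (le_of_digits_le (ONote.NF.below_of_lt' hek he)
      (ONote.NF.below_of_lt' (hlt.trans hek) he') ?_))
    rw [← htail]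
    exact fun i => by simpa [Fin.tail] using hle i.succ
  induction o generalizing o' p with
  | zero => exact absurd h (by simp [ONote.lt_def])
  | oadd e n a _ ih =>
    cases o' with
    | zero => exact ⟨_, Finset.mem_insert_self _ _, by simp [termSet]⟩
    | oadd e' n' a' =>
      rcases lt_oadd_cases ⟨_, ho'⟩ ⟨_, ho⟩ h with h1 | ⟨rfl, h1⟩ | ⟨rfl, rfl, h1⟩
      · exact ⟨_, Finset.mem_insert_self _ _, fun y hy =>
          key ho.fst ho.lt (ONote.NF.below_of_lt h1 ⟨_, ho'⟩) hy⟩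
      · refine ⟨_, Finset.mem_insert_self _ _, fun y hy => ?_⟩
        rcases Finset.mem_insert.1 hy with rfl | hy
        · intro hle
          have := hle 0
          simp only [Fin.cons_zero] at this
          omega
        · exact key ho.fst ho.lt ho'.snd hy
      -- Past a common leading term, the partial sum in `x` exceeds `p + n'`, so the vector of the
      -- common term cannot dominate `x`. This is why the first coordinate accumulates the
      -- coefficients.
      · obtain ⟨x, hx, hxy⟩ := ih (p := p + n') (ho.snd.mono ho.lt.le) (ho'.snd.mono ho'.lt.le) h1
        refine ⟨x, Finset.mem_insert_of_mem hx, fun y hy => ?_⟩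
        rcases Finset.mem_insert.1 hy with rfl | hy
        · intro hle
          have h0 := hle 0
          simp only [Fin.cons_zero] at h0
          exact absurd (of_mem_termSet ho.snd hx).1 (not_lt.2 h0)
        · exact hxy y hy

/-! ### Norm bounds for the term sets -/

theorem of_mem_exponentSet {k : ℕ} {o : ONote} {b : Ordinal} (ho : o.NFBelow b)
    {v : Fin k → ℕ} (hv : v ∈ exponentSet k o) :
    (∀ i, v i ≤ ordNorm o) ∧ ∃ e : ONote, e.NF ∧ e.repr < b ∧ v = digits k e := by
  induction o generalizing b with
  | zero => simp [exponentSet] at hv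
  | oadd e n a _ ih =>
    simp only [ordNorm]
    rcases Finset.mem_insert.1 hv with rfl | hv
    · exact ⟨fun i => (digit_le_ordNorm i e).trans (by omega), e, ho.fst, ho.lt, rfl⟩
    · obtain ⟨h1, e', h2, h3, h4⟩ := ih ho.snd hv
      exact ⟨fun i => (h1 i).trans (by omega), e', h2, h3.trans ho.lt, h4⟩

theorem card_exponentSet_le {k : ℕ} {o : ONote} {b : Ordinal} (ho : o.NFBelow b) :
    (exponentSet k o).card ≤ (ordNorm o + 1) ^ k := by
  have hsub : exponentSet k o ⊆ Fintype.piFinset fun _ => Finset.range (ordNorm o + 1) :=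
    fun v hv => by simpa [Nat.lt_succ_iff] using (of_mem_exponentSet ho hv).1
  simpa using Finset.card_le_card hsub

/-- Digits are injective on exponents below `ω^k`, so `exponentSet` has exactly one element per term
and its cardinality counts the terms. -/
theorem card_exponentSet_oadd {k : ℕ} {e a : ONote} {n : ℕ+}
    (ho : (ONote.oadd e n a).NFBelow (Ordinal.omega0 ^ (k : Ordinal))) :
    (exponentSet k (ONote.oadd e n a)).card = (exponentSet k a).card + 1 := by
  rw [exponentSet, Finset.card_insert_of_notMem]
  intro hv
  obtain ⟨-, e', he', hlt, heq⟩ := of_mem_exponentSet ho.snd hv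
  exact absurd hlt (not_lt.2 (le_of_digits_le (ONote.NF.below_of_lt' ho.lt ho.fst)
    (ONote.NF.below_of_lt' (hlt.trans ho.lt) he') heq.le))

theorem card_termSet_le {k p : ℕ} {o : ONote}
    (ho : o.NFBelow (Ordinal.omega0 ^ (k : Ordinal))) :
    (termSet k p o).card ≤ (exponentSet k o).card := by
  induction o generalizing p with
  | zero => exact Nat.zero_le _
  | oadd e n a _ ih =>
    rw [card_exponentSet_oadd ho]
    exact (Finset.card_insert_le _ _).trans (Nat.succ_le_succ (ih (ho.snd.mono ho.lt.le)))

/-- Each term adds a coefficient of at most `N` to the partial sum. -/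
theorem le_of_mem_termSet {k p N : ℕ} {o : ONote}
    (ho : o.NFBelow (Ordinal.omega0 ^ (k : Ordinal))) (hN : ordNorm o ≤ N)
    {y : Fin (k + 1) → ℕ} (hy : y ∈ termSet k p o) :
    y 0 ≤ p + N * (exponentSet k o).card ∧ ∀ i : Fin k, y i.succ ≤ N := by
  induction o generalizing p with
  | zero => simp [termSet] at hy
  | oadd e n a _ ih =>
    rw [card_exponentSet_oadd ho, mul_add_one]
    simp only [ordNorm] at hN
    rcases Finset.mem_insert.1 hy with rfl | hy
    · refine ⟨?_, fun i => ?_⟩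
      · simp only [Fin.cons_zero]
        omega
      · simp only [Fin.cons_succ]
        exact (digit_le_ordNorm i e).trans (by omega)
    · obtain ⟨h1, h2⟩ := ih (ho.snd.mono ho.lt.le) (by omega) hy
      exact ⟨by omega, h2⟩

theorem finsetNorm_termSet_le {k : ℕ} {o : ONote}
    (ho : o.NFBelow (Ordinal.omega0 ^ (k : Ordinal))) :
    finsetNorm vecNorm (termSet k 0 o) ≤ ordNorm o * (ordNorm o + 1) ^ k := by
  cases o with
  | zero => simp [finsetNorm, termSet]
  | oadd e n a =>
    -- Positivity of the norm lets the factor `ordNorm o` be inserted into the cardinality bound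
    -- `(ordNorm o + 1) ^ k`.
    have hpos : 1 ≤ ordNorm (ONote.oadd e n a) := le_trans (b := (n : ℕ)) n.pos (le_max_left _ _)
    have hcard := card_exponentSet_le (k := k) ho
    refine max_le (Finset.sup_le fun y hy => vecNorm_le_iff.2 fun i => ?_) ?_
    · obtain ⟨h1, h2⟩ := le_of_mem_termSet ho le_rfl hy
      refine Fin.cases ?_ (fun i => ?_) i
      · exact h1.trans (by rw [zero_add]; gcongr)
      · exact (h2 i).trans (Nat.le_mul_of_pos_right _ (by positivity))
    · exact ((card_termSet_le ho).trans hcard).trans (Nat.le_mul_of_pos_left _ hpos)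

theorem nfBelow_of_lt_omegaOmegaPow {k : ℕ} {β : NONote} (h : β < omegaOmegaPow k) :
    β.1.NFBelow (Ordinal.omega0 ^ (k : Ordinal)) := by
  refine ONote.NF.below_of_lt' ?_ β.2
  rw [← repr_omegaOmegaPow]
  exact h

theorem badSeqLengths_omegaOmegaPow_subset (k : ℕ) {φ g : ℕ → ℕ} (hφ : Monotone φ)
    (hφ' : ∀ m, m * (m + 1) ^ k ≤ φ m) (hg : Monotone g) (n : ℕ) :
    badSeqLengths (A := CNFBelow (omegaOmegaPow k)) (· ≤ ·) cnfNorm g n ⊆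
      badSeqLengths (A := Finset (Fin (k + 1) → ℕ)) majLE (finsetNorm vecNorm) (φ ∘ g) (φ n) := by
  refine badSeqLengths_subset (fun β => termSet k 0 β.1.1) (fun x y h => ?_) hφ
    (fun m => (Nat.le_mul_of_pos_right _ (by positivity)).trans (hφ' m)) hg
    fun x => (finsetNorm_termSet_le (nfBelow_of_lt_omegaOmegaPow x.2)).trans (hφ' _)
  by_contra hcon
  obtain ⟨v, hv, hvw⟩ := exists_mem_termSet_not_le (p := 0) (nfBelow_of_lt_omegaOmegaPow x.2)
    (nfBelow_of_lt_omegaOmegaPow y.2) (not_le.1 hcon)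
  obtain ⟨w, hw, hle⟩ := h v hv
  exact hvw w hw hle

/-- For `d ≥ 1`, `α = ω^(ω^(d-1))`, `φ(x) = x (x+1)^d`, a strictly increasing inflationary `g` and
`n ≥ N(α)`: `g_α(n) = L_{α,g}(n) ≤ L_{(P_f(ℕ^d), maj), φ∘g}(φ(n))`. The first two parts of the
conclusion say that both maximal lengths exist. -/
theorem mainTheorem6 (d : ℕ) (hd : 1 ≤ d) (g : ℕ → ℕ) (hg : StrictMono g) (hginfl : ∀ m, m ≤ g m)
    (α : NONote) (hα : α = omegaOmegaPow (d - 1)) (φ : ℕ → ℕ) (hφ : ∀ x, φ x = x * (x + 1) ^ d)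
    (n : ℕ) (hn : ordNorm α.1 ≤ n) :
    IsGreatest (badSeqLengths (A := CNFBelow α) (· ≤ ·) cnfNorm g n) (ordLength α g n) ∧
    IsGreatest (badSeqLengths (A := Finset (Fin d → ℕ)) majLE (finsetNorm vecNorm) (φ ∘ g) (φ n))
      (majLength d (φ ∘ g) (φ n)) ∧
    cichon g α.1 n = ordLength α g n ∧
    ordLength α g n ≤ majLength d (φ ∘ g) (φ n) := by
  subst hα
  obtain ⟨k, rfl⟩ : ∃ k, d = k + 1 := ⟨d - 1, by omega⟩
  obtain rfl : φ = fun x => x * (x + 1) ^ (k + 1) := funext hφ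
  have hcichon := isGreatest_cichon hginfl (omegaOmegaPow (k + 1 - 1)) hn
  have hord : ordLength (omegaOmegaPow (k + 1 - 1)) g n
      = cichon g (omegaOmegaPow (k + 1 - 1)).1 n := hcichon.csSup_eq
  have hmaj : IsGreatest _ (majLength (k + 1) ((fun x => x * (x + 1) ^ (k + 1)) ∘ g)
      (n * (n + 1) ^ (k + 1))) :=
    isGreatest_lengthFn wellQuasiOrdered_majLE (finite_finsetNorm_vecNorm_le (k + 1))
  rw [hord]
  refine ⟨hcichon, hmaj, rfl, hmaj.2 (badSeqLengths_omegaOmegaPow_subset k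
    (φ := fun x => x * (x + 1) ^ (k + 1)) ?_ ?_ hg.monotone n hcichon.1)⟩
  · intro a b hab
    dsimp only
    gcongr
  -- The reflection only needs exponent `k = d - 1`; the exponent `d` of `φ` leaves room to spare.
  · intro m
    gcongr <;> omega
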